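/- Let $p=11$, let $n\ge 3$ be an odd integer, and let $d=\frac{p^n+1}{12}+\frac{p^n-1}{2}$, which is a positive integer. Then the power function $f(x)=x^d$ on the finite field $\mathbb{F}_{p^n}$ is differentially $6$-uniform, i.e. $$\max_{a\in\mathbb{F}_{p^n}^*,\ b\in\mathbb{F}_{p^n}} \#\{x\in\mathbb{F}_{p^n} : f(x+a)-f(x)=b\}=6 .$$ -/

import Mathlib

/-- `N(a, b)`: the number of solutions `x` of `f (x + a) - f x = b` in the finite field `F`. -/
noncomputable def differentialCount {F : Type*} [Field F] (f : F → F) (a b : F) : ℕ :=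
  Nat.card {x : F // f (x + a) - f x = b}

open Classical in
/-- The differential uniformity of `f`: the maximum of `N(a, b)` over `a ≠ 0` and all `b`
(over a finite field the set of such pairs is finite and nonempty, so this is a genuine maximum). -/
noncomputable def differentialUniformity {F : Type*} [Field F] [Fintype F] (f : F → F) : ℕ :=
  (Finset.univ.filter fun ab : F × F => ab.1 ≠ 0).sup fun ab => differentialCount f ab.1 ab.2

/-- `f` is differentially `k`-uniform if its differential uniformity equals `k`. -/
def IsDifferentiallyUniform {F : Type*} [Field F] [Fintype F] (f : F → F) (k : ℕ) : Prop :=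
  differentialUniformity f = k

/-! Put q = 11 ^ n. As -1 is a nonsquare and every square is a twelfth power, each x is ±w ^ 12, and
x ^ d = w ^ 2. With a = 1 the equation becomes v ^ 2 - w ^ 2 = b, εv ^ 12 - δw ^ 12 = 1. Set t = v +
w, m = v - w, so tm = b; Frobenius makes the second condition b(t ^ 10 + m ^ 10) = ±2 for equal
signs and t ^ 12 + m ^ 12 = ±2 for opposite signs. For b ≠ 0, `not_opposite_sums` leaves one system
of each kind; the first has at most 5 solutions x (a quintic in w ^ 2), the second at most 1
(`sq_eq_sq_of_equal_sums`). For equality, t = βy, m = ηβ/y turns the first condition into one on y ^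
10, invariant under y ↦ ky with k in the prime field: this gives five solutions, and the same β, η
serve the second system. -/

/-! ### Arithmetic of 11 ^ n and identities in characteristic 11 -/

theorem neg_one_ne_sq {F : Type*} [Field F] [Fintype F] {n : ℕ} (hn : Odd n)
    (hF : Fintype.card F = 11 ^ n) (x : F) : x ^ 2 ≠ -1 := by
  intro h
  have h1 : IsSquare (-1 : F) := ⟨x, by rw [← h, sq]⟩
  rw [FiniteField.isSquare_neg_one_iff, hF] at h1
  obtain ⟨k, rfl⟩ := hn
  apply h1
  rw [pow_succ, pow_mul, Nat.mul_mod, Nat.pow_mod]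
  norm_num

theorem charP_eleven {F : Type*} [Field F] [Fintype F] {n : ℕ}
    (hF : Fintype.card F = 11 ^ n) : CharP F 11 := by
  have : Fact (Nat.Prime 11) := ⟨by norm_num⟩
  exact charP_of_card_eq_prime_pow hF

theorem eleven_pow_exponents {n : ℕ} (hn : Odd n) :
    12 * ((11 ^ n + 1) / 12) = 11 ^ n + 1 ∧
      Even ((11 ^ n + 1) / 12 + (11 ^ n - 1) / 2) ∧
      12 * ((11 ^ n + 1) / 12 + (11 ^ n - 1) / 2) = 6 * (11 ^ n - 1) + 11 ^ n + 1 := by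
  -- Modulus 24 also gives the parity of the exponent.
  have h : 11 ^ n % 24 = 11 := by
    obtain ⟨k, rfl⟩ := hn
    rw [pow_succ, pow_mul, Nat.mul_mod, Nat.pow_mod]
    norm_num
  generalize 11 ^ n = q at *
  refine ⟨by omega, ?_, by omega⟩
  rw [Nat.even_iff]
  omega

theorem two_ne_zero_of_charP_eleven {F : Type*} [Field F] [CharP F 11] : (2 : F) ≠ 0 := by
  intro h
  have := (CharP.cast_eq_zero_iff F 11 2).1 (by exact_mod_cast h)
  norm_num at this

/-- Since (v ± w) ^ 11 = v ^ 11 ± w ^ 11, multiplying by v ∓ w and adding gives this. -/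
theorem add_mul_pow_ten {F : Type*} [Field F] [CharP F 11] (v w : F) :
    (v ^ 2 - w ^ 2) * ((v + w) ^ 10 + (v - w) ^ 10) = 2 * (v ^ 12 - w ^ 12) := by
  have : Fact (Nat.Prime 11) := ⟨by norm_num⟩
  have h1 := add_pow_char v w 11
  have h2 := sub_pow_char (p := 11) v w
  linear_combination (v - w) * h1 + (v + w) * h2

theorem add_pow_twelve_add_sub_pow_twelve {F : Type*} [Field F] [CharP F 11] (v w : F) :
    (v + w) ^ 12 + (v - w) ^ 12 = 2 * (v ^ 12 + w ^ 12) := by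
  have : Fact (Nat.Prime 11) := ⟨by norm_num⟩
  have h1 := add_pow_char v w 11
  have h2 := sub_pow_char (p := 11) v w
  linear_combination (v + w) * h1 + (v - w) * h2

theorem add_ne_zero_of_sq_sub_sq_ne_zero {F : Type*} [Field F] {v w b : F} (hb : b ≠ 0) (h : v ^ 2 - w ^ 2 = b) :
    v + w ≠ 0 := by
  intro h0
  apply hb
  linear_combination (v - w) * h0 - h

theorem natCast_pow_ten_eq_one {F : Type*} [Field F] [CharP F 11] {k : ℕ} (hk : (k : F) ≠ 0) : (k : F) ^ 10 = 1 := by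
  have : Fact (Nat.Prime 11) := ⟨by norm_num⟩
  have h : (k : F) ^ 11 = k := by
    have := congrArg (ZMod.castHom (dvd_refl 11) F) (ZMod.pow_card (k : ZMod 11))
    rwa [map_pow, map_natCast] at this
  apply mul_left_cancel₀ hk
  linear_combination h

theorem natCast_ne_zero_of_lt {F : Type*} [Field F] [CharP F 11] {k : ℕ} (h0 : k ≠ 0) (hk : k < 11) : (k : F) ≠ 0 := by
  intro h
  have := Nat.le_of_dvd (Nat.pos_of_ne_zero h0) ((CharP.cast_eq_zero_iff F 11 k).1 h)
  omega

theorem natCast_sq_injective {F : Type*} [Field F] [CharP F 11] {i j : Fin 5}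
    (h : (((i : ℕ) + 1 : ℕ) : F) ^ 2 = (((j : ℕ) + 1 : ℕ) : F) ^ 2) : i = j := by
  rcases sq_eq_sq_iff_eq_or_eq_neg.1 h with h | h
  · have := CharP.natCast_injOn_Iio F 11 (by simp; omega) (by simp; omega) h
    exact Fin.ext (by omega)
  · refine absurd ?_ (natCast_ne_zero_of_lt (F := F) (k := (i + 1) + (j + 1)) (by omega) (by omega))
    rw [Nat.cast_add, h, neg_add_cancel]

/-! ### Signed systems and the quintic bound -/

/-- `v, w` are twelfth roots of `x + 1, x` up to the signs `ε, δ`, and `v ^ 2 - w ^ 2 = b`. -/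
def SignedSolution {F : Type*} [Field F] (b ε δ x : F) : Prop :=
  ∃ v w : F, x = δ * w ^ 12 ∧ x + 1 = ε * v ^ 12 ∧ v ^ 2 - w ^ 2 = b

open Polynomial in
theorem card_signedSolution_same_le {F : Type*} [Field F] [CharP F 11] [DecidableEq F] {b ε : F}
    (hε : ε * ε = 1) (hb : b ≠ 0) (s : Finset F) (hs : ∀ x ∈ s, SignedSolution b ε ε x) :
    s.card ≤ 5 := by
  have h6 : (6 : F) ≠ 0 := by
    intro h
    have := (CharP.cast_eq_zero_iff F 11 6).1 (by exact_mod_cast h)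
    norm_num at this
  -- This is (X + b) ^ 6 - X ^ 6 - ε expanded; it vanishes at w ^ 2.
  set P : F[X] := C (6 * b) * X ^ 5 + C (15 * b ^ 2) * X ^ 4 + C (20 * b ^ 3) * X ^ 3
    + C (15 * b ^ 4) * X ^ 2 + C (6 * b ^ 5) * X + C (b ^ 6 - ε) with hP
  have hdeg : P.natDegree = 5 := by
    rw [hP]
    compute_degree!
  have hP0 : P ≠ 0 := by
    intro h
    rw [h] at hdeg
    simp at hdeg
  have hsub : s ⊆ P.roots.toFinset.image fun u => ε * u ^ 6 := by
    intro x hx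
    obtain ⟨v, w, h1, h2, h3⟩ := hs x hx
    refine Finset.mem_image.2 ⟨w ^ 2, ?_, by rw [h1]; ring⟩
    rw [Multiset.mem_toFinset, mem_roots hP0, IsRoot.def, hP]
    simp only [eval_add, eval_mul, eval_C, eval_pow, eval_X]
    have h4 : v ^ 12 = (w ^ 2 + b) ^ 6 := by rw [← h3]; ring
    rw [h4] at h2
    linear_combination ε * (h1 - h2) + (w ^ 12 - (w ^ 2 + b) ^ 6) * hε
  calc s.card ≤ _ := Finset.card_le_card hsub
    _ ≤ P.roots.toFinset.card := Finset.card_image_le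
    _ ≤ Multiset.card P.roots := Multiset.toFinset_card_le _
    _ ≤ P.natDegree := P.card_roots'
    _ = 5 := hdeg

/-! ### The power map through twelfth roots -/

section

variable {F : Type*} [Field F] [Fintype F] {n : ℕ}

theorem pow_card_add_one_eq_sq (hF : Fintype.card F = 11 ^ n) (x : F) :
    x ^ (11 ^ n + 1) = x ^ 2 := by
  rw [pow_succ, ← hF, FiniteField.pow_card, sq]

/-- Raising to the power (q + 1) / 12 takes x ^ 12 to x ^ (q + 1) = x ^ 2. -/
theorem sq_eq_sq_of_pow_twelve_eq (hn : Odd n) (hF : Fintype.card F = 11 ^ n) {x y : F}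
    (h : x ^ 12 = y ^ 12) : x ^ 2 = y ^ 2 := by
  rw [← pow_card_add_one_eq_sq hF x, ← pow_card_add_one_eq_sq hF y,
    ← (eleven_pow_exponents hn).1, pow_mul, pow_mul, h]

theorem exists_pow_twelve_eq_sq (hn : Odd n) (hF : Fintype.card F = 11 ^ n) (x : F) :
    ∃ w : F, w ^ 12 = x ^ 2 :=
  ⟨x ^ ((11 ^ n + 1) / 12), by
    rw [← pow_mul, mul_comm, (eleven_pow_exponents hn).1, pow_card_add_one_eq_sq hF]⟩

theorem exists_eq_pow_twelve_or_neg (hn : Odd n) (hF : Fintype.card F = 11 ^ n) (x : F) :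
    ∃ w : F, x = w ^ 12 ∨ x = -w ^ 12 := by
  have key : IsSquare x ∨ IsSquare (-x) := by
    classical
    by_contra! h
    have hx : x ≠ 0 := fun h0 => h.1 (h0 ▸ IsSquare.zero)
    have h1 := quadraticChar_neg_one_iff_not_isSquare.2 h.1
    have h2 := quadraticChar_neg_one_iff_not_isSquare.2 h.2
    have h3 : ¬ IsSquare (-1 : F) := by
      rintro ⟨y, hy⟩
      exact neg_one_ne_sq hn hF y (by rw [hy, sq])
    have h4 := quadraticChar_neg_one_iff_not_isSquare.2 h3
    rw [neg_eq_neg_one_mul, map_mul, h1, h4] at h2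
    norm_num at h2
  rcases key with ⟨y, hy⟩ | ⟨y, hy⟩
  · obtain ⟨w, hw⟩ := exists_pow_twelve_eq_sq hn hF y
    exact ⟨w, Or.inl (by rw [hw, hy, sq])⟩
  · obtain ⟨w, hw⟩ := exists_pow_twelve_eq_sq hn hF y
    exact ⟨w, Or.inr (by rw [hw, sq, ← hy, neg_neg])⟩

theorem pow_exponent_pow_twelve (hn : Odd n) (hF : Fintype.card F = 11 ^ n) (w : F) :
    (w ^ 12) ^ ((11 ^ n + 1) / 12 + (11 ^ n - 1) / 2) = w ^ 2 := by
  rw [← pow_mul, (eleven_pow_exponents hn).2.2]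
  rcases eq_or_ne w 0 with rfl | hw
  · rw [zero_pow (by omega), zero_pow two_ne_zero]
  · rw [add_assoc, pow_add, pow_card_add_one_eq_sq hF, mul_comm 6, pow_mul, ← hF,
      FiniteField.pow_card_sub_one_eq_one w hw, one_pow, one_mul]

theorem pow_exponent_of_eq_or_neg (hn : Odd n) (hF : Fintype.card F = 11 ^ n) {x w : F}
    (h : x = w ^ 12 ∨ x = -w ^ 12) :
    x ^ ((11 ^ n + 1) / 12 + (11 ^ n - 1) / 2) = w ^ 2 := by
  rcases h with rfl | rfl
  · exact pow_exponent_pow_twelve hn hF w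
  · rw [(eleven_pow_exponents hn).2.1.neg_pow, pow_exponent_pow_twelve hn hF w]

/-! ### Pairs with prescribed product and power sum -/

/-- Two pairs with equal nonzero product whose even powers have opposite sums cannot coexist,
as `-1` is not a square. -/
theorem not_opposite_sums (hn : Odd n) (hF : Fintype.card F = 11 ^ n) {k : ℕ}
    {t m t' m' : F} (ht : t ≠ 0) (hp : t * m = t' * m')
    (hs : t ^ (2 * k) + m ^ (2 * k) = -(t' ^ (2 * k) + m' ^ (2 * k))) : False := by
  have hq : t ^ (2 * k) * m ^ (2 * k) = t' ^ (2 * k) * m' ^ (2 * k) := by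
    rw [← mul_pow, ← mul_pow, hp]
  -- The powers of t, m and the negated powers of t', m' are roots of the same quadratic.
  have h : (t ^ (2 * k) + t' ^ (2 * k)) * (t ^ (2 * k) + m' ^ (2 * k)) = 0 := by
    linear_combination t ^ (2 * k) * hs - hq
  have aux : ∀ y : F, t ^ (2 * k) + y ^ (2 * k) ≠ 0 := by
    intro y hy
    apply neg_one_ne_sq hn hF (y ^ k / t ^ k)
    have hk : t ^ k ≠ 0 := pow_ne_zero _ ht
    rw [pow_mul', pow_mul'] at hy
    rw [div_pow, div_eq_iff (pow_ne_zero _ hk)]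
    linear_combination hy
  rcases mul_eq_zero.1 h with h | h
  · exact aux _ h
  · exact aux _ h

/-- The twelfth powers of v ± w have the same sum and product as those of v' ± w', so they agree up
to order. Hence so do the squares, and the sum of squares together with v ^ 2 - w ^ 2 determines w ^
2. -/
theorem sq_eq_sq_of_equal_sums (hn : Odd n) (hF : Fintype.card F = 11 ^ n) [CharP F 11]
    {v w v' w' : F} (hb : v ^ 2 - w ^ 2 ≠ 0) (hp : v ^ 2 - w ^ 2 = v' ^ 2 - w' ^ 2)
    (hs : v ^ 12 + w ^ 12 = v' ^ 12 + w' ^ 12) : w ^ 2 = w' ^ 2 := by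
  have h1 := add_pow_twelve_add_sub_pow_twelve v w
  have h2 := add_pow_twelve_add_sub_pow_twelve v' w'
  have hp' : (v + w) * (v - w) = (v' + w') * (v' - w') := by linear_combination hp
  have hq : (v + w) ^ 12 * (v - w) ^ 12 = (v' + w') ^ 12 * (v' - w') ^ 12 := by
    rw [← mul_pow, ← mul_pow, hp']
  have h : ((v + w) ^ 12 - (v' + w') ^ 12) * ((v + w) ^ 12 - (v' - w') ^ 12) = 0 := by
    linear_combination (v + w) ^ 12 * (h1 - h2 + 2 * hs) - hq
  have ht : (v + w) ^ 2 ≠ 0 := by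
    intro h
    apply hb
    have h' := (pow_eq_zero_iff two_ne_zero).1 h
    linear_combination (v - w) * h'
  have h4 : (4 : F) ≠ 0 := by
    have h0 := two_ne_zero_of_charP_eleven (F := F)
    intro h
    exact mul_ne_zero h0 h0 (by linear_combination h)
  have hq2 : (v + w) ^ 2 * (v - w) ^ 2 = (v' + w') ^ 2 * (v' - w') ^ 2 := by
    rw [← mul_pow, ← mul_pow, hp']
  rcases mul_eq_zero.1 h with h | h
  · have h5 := sq_eq_sq_of_pow_twelve_eq hn hF (sub_eq_zero.1 h)
    have h6 : (v - w) ^ 2 = (v' - w') ^ 2 := by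
      apply mul_left_cancel₀ ht
      rw [hq2, h5]
    apply mul_left_cancel₀ h4
    linear_combination h5 + h6 - 2 * hp
  · have h5 := sq_eq_sq_of_pow_twelve_eq hn hF (sub_eq_zero.1 h)
    have h6 : (v - w) ^ 2 = (v' + w') ^ 2 := by
      apply mul_left_cancel₀ ht
      rw [hq2, h5, mul_comm]
    apply mul_left_cancel₀ h4
    linear_combination h5 + h6 - 2 * hp

/-! ### Upper bound: at most six solutions -/

theorem exists_signedSolution (hn : Odd n) (hF : Fintype.card F = 11 ^ n) {b x : F}
    (hx : (x + 1) ^ ((11 ^ n + 1) / 12 + (11 ^ n - 1) / 2)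
      - x ^ ((11 ^ n + 1) / 12 + (11 ^ n - 1) / 2) = b) :
    (SignedSolution b 1 1 x ∨ SignedSolution b (-1) (-1) x) ∨
      (SignedSolution b 1 (-1) x ∨ SignedSolution b (-1) 1 x) := by
  obtain ⟨w, hw⟩ := exists_eq_pow_twelve_or_neg hn hF x
  obtain ⟨v, hv⟩ := exists_eq_pow_twelve_or_neg hn hF (x + 1)
  rw [pow_exponent_of_eq_or_neg hn hF hw, pow_exponent_of_eq_or_neg hn hF hv] at hx
  rcases hw with hw | hw <;> rcases hv with hv | hv
  · exact Or.inl (Or.inl ⟨v, w, by rw [hw]; ring, by rw [hv]; ring, hx⟩)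
  · exact Or.inr (Or.inr ⟨v, w, by rw [hw]; ring, by rw [hv]; ring, hx⟩)
  · exact Or.inr (Or.inl ⟨v, w, by rw [hw]; ring, by rw [hv]; ring, hx⟩)
  · exact Or.inl (Or.inr ⟨v, w, by rw [hw]; ring, by rw [hv]; ring, hx⟩)

/-- The two systems would give tenth-power sums 2 / b and -2 / b with the same product b. -/
theorem signedSolution_same_exclusive (hn : Odd n) (hF : Fintype.card F = 11 ^ n) [CharP F 11]
    {b x y : F} (hb : b ≠ 0) (hx : SignedSolution b 1 1 x) (hy : SignedSolution b (-1) (-1) y) :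
    False := by
  obtain ⟨v, w, h1, h2, h3⟩ := hx
  obtain ⟨v', w', h1', h2', h3'⟩ := hy
  refine not_opposite_sums hn hF (k := 5) (add_ne_zero_of_sq_sub_sq_ne_zero hb h3)
    (m := v - w) (t' := v' + w') (m' := v' - w') (by linear_combination h3 - h3') ?_
  have e1 := add_mul_pow_ten v w
  have e2 := add_mul_pow_ten v' w'
  rw [h3] at e1
  rw [h3'] at e2
  apply mul_left_cancel₀ hb
  linear_combination e1 + e2 + 2 * (h1 - h2) + 2 * (h2' - h1')

theorem signedSolution_opposite_exclusive (hn : Odd n) (hF : Fintype.card F = 11 ^ n) [CharP F 11]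
    {b x y : F} (hb : b ≠ 0) (hx : SignedSolution b 1 (-1) x) (hy : SignedSolution b (-1) 1 y) :
    False := by
  obtain ⟨v, w, h1, h2, h3⟩ := hx
  obtain ⟨v', w', h1', h2', h3'⟩ := hy
  refine not_opposite_sums hn hF (k := 6) (add_ne_zero_of_sq_sub_sq_ne_zero hb h3)
    (m := v - w) (t' := v' + w') (m' := v' - w') (by linear_combination h3 - h3') ?_
  have e1 := add_pow_twelve_add_sub_pow_twelve v w
  have e2 := add_pow_twelve_add_sub_pow_twelve v' w'
  linear_combination e1 + e2 + 2 * (h1 - h2) + 2 * (h2' - h1')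

theorem signedSolution_opposite_unique (hn : Odd n) (hF : Fintype.card F = 11 ^ n) [CharP F 11]
    {b ε x y : F} (hε : ε * ε = 1) (hb : b ≠ 0) (hx : SignedSolution b ε (-ε) x)
    (hy : SignedSolution b ε (-ε) y) : x = y := by
  obtain ⟨v, w, h1, h2, h3⟩ := hx
  obtain ⟨v', w', h1', h2', h3'⟩ := hy
  have h := sq_eq_sq_of_equal_sums hn hF (by rwa [h3]) (h3.trans h3'.symm)
    (by linear_combination ε * (h1 - h2) - ε * (h1' - h2')
      - (v ^ 12 + w ^ 12 - v' ^ 12 - w' ^ 12) * hε)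
  have h12 : w ^ 12 = w' ^ 12 := by
    calc w ^ 12 = (w ^ 2) ^ 6 := by ring
      _ = (w' ^ 2) ^ 6 := by rw [h]
      _ = w' ^ 12 := by ring
  rw [h1, h1', h12]

theorem card_solutions_zero_le (hn : Odd n) (hF : Fintype.card F = 11 ^ n) [CharP F 11]
    (s : Finset F) (hs : ∀ x ∈ s, (x + 1) ^ ((11 ^ n + 1) / 12 + (11 ^ n - 1) / 2)
      - x ^ ((11 ^ n + 1) / 12 + (11 ^ n - 1) / 2) = 0) : s.card ≤ 1 := by
  have h2 := two_ne_zero_of_charP_eleven (F := F)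
  -- Here v ^ 12 = w ^ 12: equal signs give 1 = 0, opposite signs x + 1 = -x.
  have key : ∀ x ∈ s, x = -1 / 2 := by
    intro x hx
    have aux : ∀ v w : F, v ^ 2 - w ^ 2 = 0 → v ^ 12 = w ^ 12 := by
      intro v w h
      calc v ^ 12 = (v ^ 2) ^ 6 := by ring
        _ = (w ^ 2) ^ 6 := by rw [sub_eq_zero.1 h]
        _ = w ^ 12 := by ring
    rw [eq_div_iff h2]
    rcases exists_signedSolution hn hF (hs x hx) with
      (⟨v, w, e1, e2, e3⟩ | ⟨v, w, e1, e2, e3⟩) | ⟨v, w, e1, e2, e3⟩ | ⟨v, w, e1, e2, e3⟩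
    · exact absurd (by linear_combination e2 - e1 + aux v w e3) (one_ne_zero (α := F))
    · exact absurd (by linear_combination e2 - e1 - aux v w e3) (one_ne_zero (α := F))
    · linear_combination e1 + e2 + aux v w e3
    · linear_combination e1 + e2 - aux v w e3
  exact Finset.card_le_one.2 fun x hx y hy => (key x hx).trans (key y hy).symm

theorem card_solutions_le_six (hn : Odd n) (hF : Fintype.card F = 11 ^ n) [CharP F 11] (b : F)
    (s : Finset F) (hs : ∀ x ∈ s, (x + 1) ^ ((11 ^ n + 1) / 12 + (11 ^ n - 1) / 2)
      - x ^ ((11 ^ n + 1) / 12 + (11 ^ n - 1) / 2) = b) : s.card ≤ 6 := by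
  classical
  rcases eq_or_ne b 0 with rfl | hb
  · exact (card_solutions_zero_le hn hF s hs).trans (by norm_num)
  set P := s.filter fun x => SignedSolution b 1 1 x ∨ SignedSolution b (-1) (-1) x with hP
  set Q := s.filter fun x => SignedSolution b 1 (-1) x ∨ SignedSolution b (-1) 1 x with hQ
  have hsub : s ⊆ P ∪ Q := by
    intro x hx
    rw [Finset.mem_union, hP, hQ, Finset.mem_filter, Finset.mem_filter]
    exact (exists_signedSolution hn hF (hs x hx)).imp (⟨hx, ·⟩) (⟨hx, ·⟩)
  have hPc : P.card ≤ 5 := by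
    by_cases h : ∃ x, SignedSolution b 1 1 x
    · obtain ⟨x, hx⟩ := h
      refine card_signedSolution_same_le (ε := 1) (by ring) hb P fun y hy => ?_
      exact (Finset.mem_filter.1 hy).2.resolve_right
        fun h => signedSolution_same_exclusive hn hF hb hx h
    · refine card_signedSolution_same_le (ε := -1) (by ring) hb P fun y hy => ?_
      exact (Finset.mem_filter.1 hy).2.resolve_left fun h' => h ⟨y, h'⟩
  have hQc : Q.card ≤ 1 := by
    refine Finset.card_le_one.2 fun x hx y hy => ?_
    rcases (Finset.mem_filter.1 hx).2 with hx | hx <;>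
      rcases (Finset.mem_filter.1 hy).2 with hy | hy
    · exact signedSolution_opposite_unique hn hF (ε := 1) (by ring) hb hx hy
    · exact (signedSolution_opposite_exclusive hn hF hb hx hy).elim
    · exact (signedSolution_opposite_exclusive hn hF hb hy hx).elim
    · refine signedSolution_opposite_unique hn hF (ε := -1) (by ring) hb ?_ ?_ <;>
        rwa [neg_neg]
  calc s.card ≤ (P ∪ Q).card := Finset.card_le_card hsub
    _ ≤ P.card + Q.card := Finset.card_union_le _ _
    _ ≤ 6 := by omega

/-! ### Lower bound: a value b attained six times -/

theorem sub_eq_of_signedSolution (hn : Odd n) (hF : Fintype.card F = 11 ^ n) {b ε δ x : F}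
    (hε : ε = 1 ∨ ε = -1) (hδ : δ = 1 ∨ δ = -1) (hx : SignedSolution b ε δ x) :
    (x + 1) ^ ((11 ^ n + 1) / 12 + (11 ^ n - 1) / 2)
      - x ^ ((11 ^ n + 1) / 12 + (11 ^ n - 1) / 2) = b := by
  obtain ⟨v, w, h1, h2, h3⟩ := hx
  rw [pow_exponent_of_eq_or_neg hn hF (w := v), pow_exponent_of_eq_or_neg hn hF (w := w), h3]
  · rcases hδ with rfl | rfl
    · exact Or.inl (by rw [h1, one_mul])
    · exact Or.inr (by rw [h1, neg_one_mul])
  · rcases hε with rfl | rfl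
    · exact Or.inl (by rw [h2, one_mul])
    · exact Or.inr (by rw [h2, neg_one_mul])

theorem eq_zero_of_pow_twelve_eq_neg (hn : Odd n) (hF : Fintype.card F = 11 ^ n) {w w' : F}
    (h : w ^ 12 = -w' ^ 12) : w = 0 := by
  by_contra hw
  have hw' : w ^ 6 ≠ 0 := pow_ne_zero _ hw
  apply neg_one_ne_sq hn hF (w' ^ 6 / w ^ 6)
  rw [div_pow, div_eq_iff (pow_ne_zero _ hw')]
  linear_combination h

/-- The equal-sign and opposite-sign systems share a solution only for `η = b = 1`. -/
theorem eq_one_of_signedSolution_same_opposite (hn : Odd n) (hF : Fintype.card F = 11 ^ n)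
    {b η x : F} (hη : η = 1 ∨ η = -1) (hx : SignedSolution b 1 1 x)
    (hy : SignedSolution b η (-η) x) : η = 1 ∧ b = 1 := by
  obtain ⟨v, w, h1, h2, h3⟩ := hx
  obtain ⟨v', w', h1', h2', h3'⟩ := hy
  rcases hη with rfl | rfl
  · have hw : w = 0 :=
      eq_zero_of_pow_twelve_eq_neg hn hF (w' := w') (by linear_combination h1' - h1)
    subst hw
    have hv : v ^ 12 = 1 ^ 12 := by linear_combination h1 - h2
    have := sq_eq_sq_of_pow_twelve_eq hn hF hv
    exact ⟨rfl, by linear_combination this - h3⟩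
  · have hv : v = 0 :=
      eq_zero_of_pow_twelve_eq_neg hn hF (w' := v') (by linear_combination h2' - h2)
    subst hv
    exact absurd (by linear_combination h2 - h1) (neg_one_ne_sq hn hF (w ^ 6))

theorem exists_pow_ten_ne_one (hn3 : 3 ≤ n) (hF : Fintype.card F = 11 ^ n) :
    ∃ z : F, z ≠ 0 ∧ z ^ 10 ≠ 1 := by
  classical
  by_contra! h
  have hsub : (Finset.univ : Finset F) ⊆ insert 0 (Polynomial.nthRootsFinset 10 (1 : F)) := by
    intro z _
    rw [Finset.mem_insert, Polynomial.mem_nthRootsFinset (by norm_num)]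
    by_cases hz : z = 0
    · exact Or.inl hz
    · exact Or.inr (h z hz)
  have h1 := Finset.card_le_card hsub
  have h2 := Finset.card_insert_le 0 (Polynomial.nthRootsFinset 10 (1 : F))
  have h3 : (Polynomial.nthRootsFinset 10 (1 : F)).card ≤ 10 := by
    rw [Polynomial.nthRootsFinset]
    exact (Multiset.toFinset_card_le _).trans (Polynomial.card_nthRoots 10 1)
  rw [Finset.card_univ, hF] at h1
  have h4 : 11 ^ 3 ≤ 11 ^ n := Nat.pow_le_pow_right (by norm_num) hn3
  omega

/-- The equation making both sign systems solvable with `b = η * β ^ 2`. -/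
theorem exists_sign_pow_twelve (hn : Odd n) (hF : Fintype.card F = 11 ^ n) [CharP F 11] {z : F}
    (hz : z ≠ 0) : ∃ β η : F, β ≠ 0 ∧ (η = 1 ∨ η = -1) ∧
      η * β ^ 12 * (1 + z ^ 20) = 2 * z ^ 10 := by
  have h2 := two_ne_zero_of_charP_eleven (F := F)
  have hz20 : 1 + z ^ 20 ≠ 0 := fun h =>
    neg_one_ne_sq hn hF (z ^ 10) (by linear_combination h)
  have hC : 2 * z ^ 10 / (1 + z ^ 20) ≠ 0 := div_ne_zero (mul_ne_zero h2 (pow_ne_zero _ hz)) hz20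
  obtain ⟨β, h⟩ := exists_eq_pow_twelve_or_neg hn hF (2 * z ^ 10 / (1 + z ^ 20))
  have hβ : β ≠ 0 := by
    rintro rfl
    apply hC
    rcases h with h | h <;> simpa using h
  rcases h with h | h
  · exact ⟨β, 1, hβ, Or.inl rfl, by rw [one_mul, ← h, div_mul_cancel₀ _ hz20]⟩
  · exact ⟨β, -1, hβ, Or.inr rfl, by rw [neg_one_mul, ← h, div_mul_cancel₀ _ hz20]⟩

/-- The second conclusion is 4w ^ 2 = (t - m) ^ 2; it separates the solutions coming from different
y. -/
theorem exists_signedSolution_same (hn : Odd n) (hF : Fintype.card F = 11 ^ n) [CharP F 11]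
    {β η y : F} (hη : η = 1 ∨ η = -1) (hy : y ≠ 0)
    (h : η * β ^ 12 * (1 + y ^ 20) = 2 * y ^ 10) :
    ∃ x, SignedSolution (η * β ^ 2) 1 1 x ∧
      4 * x ^ ((11 ^ n + 1) / 12 + (11 ^ n - 1) / 2) =
        β ^ 2 * (y ^ 2 + (y ^ 2)⁻¹) - 2 * (η * β ^ 2) := by
  have h2 := two_ne_zero_of_charP_eleven (F := F)
  have hη2 : η ^ 2 = 1 := by rcases hη with rfl | rfl <;> ring
  have hη10 : η ^ 10 = 1 := by rw [show 10 = 2 * 5 from rfl, pow_mul, hη2, one_pow]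
  set t := β * y with ht
  set m := η * β * y⁻¹ with hm
  have htm : t * m = η * β ^ 2 := by
    rw [ht, hm]
    field_simp
  have ht2 : (t + m) / 2 + (t - m) / 2 = t := by field_simp; ring
  have hm2 : (t + m) / 2 - (t - m) / 2 = m := by field_simp; ring
  have hvw : ((t + m) / 2) ^ 2 - ((t - m) / 2) ^ 2 = η * β ^ 2 := by
    rw [← htm]
    linear_combination ((t + m) / 2 - (t - m) / 2) * ht2 + t * hm2
  have e := add_mul_pow_ten ((t + m) / 2) ((t - m) / 2)
  rw [hvw, ht2, hm2] at e
  have e' : η * β ^ 2 * (t ^ 10 + m ^ 10) = 2 := by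
    rw [ht, hm, mul_pow, mul_pow, mul_pow, hη10, inv_pow]
    have hy10 : y ^ 10 ≠ 0 := pow_ne_zero _ hy
    field_simp
    linear_combination h
  refine ⟨((t - m) / 2) ^ 12, ⟨(t + m) / 2, (t - m) / 2, (one_mul _).symm, ?_, hvw⟩, ?_⟩
  · apply mul_left_cancel₀ h2
    linear_combination e - e'
  · rw [pow_exponent_pow_twelve hn hF]
    have : 4 * ((t - m) / 2) ^ 2 = t ^ 2 + m ^ 2 - 2 * (η * β ^ 2) := by
      rw [← htm]
      field_simp
      ring
    rw [this, ht, hm, mul_pow, mul_pow, mul_pow, hη2, inv_pow]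
    ring

theorem exists_signedSolution_opposite (hn : Odd n) (hF : Fintype.card F = 11 ^ n) [CharP F 11]
    {β η z : F} (hη : η = 1 ∨ η = -1) (hz : z ≠ 0)
    (h : η * β ^ 12 * (1 + z ^ 20) = 2 * z ^ 10) :
    ∃ x, SignedSolution (η * β ^ 2) η (-η) x := by
  have h2 := two_ne_zero_of_charP_eleven (F := F)
  have hη2 : η ^ 2 = 1 := by rcases hη with rfl | rfl <;> ring
  have hη12 : η ^ 12 = 1 := by rw [show 12 = 2 * 6 from rfl, pow_mul, hη2, one_pow]
  -- With ρ ^ 12 = z ^ 10, twelfth powers here reproduce the tenth powers of the equal-sign system.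
  obtain ⟨ρ, hρ⟩ := exists_pow_twelve_eq_sq hn hF (z ^ 5)
  have hρ0 : ρ ≠ 0 := by
    rintro rfl
    exact hz (by simpa using hρ.symm)
  set t := β * ρ with ht
  set m := η * β * ρ⁻¹ with hm
  have htm : t * m = η * β ^ 2 := by
    rw [ht, hm]
    field_simp
  have ht2 : (t + m) / 2 + (t - m) / 2 = t := by field_simp; ring
  have hm2 : (t + m) / 2 - (t - m) / 2 = m := by field_simp; ring
  have hvw : ((t + m) / 2) ^ 2 - ((t - m) / 2) ^ 2 = η * β ^ 2 := by
    rw [← htm]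
    linear_combination ((t + m) / 2 - (t - m) / 2) * ht2 + t * hm2
  have e := add_pow_twelve_add_sub_pow_twelve ((t + m) / 2) ((t - m) / 2)
  rw [ht2, hm2] at e
  have e' : η * (t ^ 12 + m ^ 12) = 2 := by
    rw [ht, hm, mul_pow, mul_pow, mul_pow, hη12, inv_pow, hρ]
    field_simp
    linear_combination h
  refine ⟨-η * ((t - m) / 2) ^ 12, (t + m) / 2, (t - m) / 2, rfl, ?_, hvw⟩
  apply mul_left_cancel₀ h2
  linear_combination η * e - e'

theorem exists_six_solutions (hn : Odd n) (hn3 : 3 ≤ n) (hF : Fintype.card F = 11 ^ n)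
    [CharP F 11] : ∃ (b : F) (s : Finset F), s.card = 6 ∧
      ∀ x ∈ s, (x + 1) ^ ((11 ^ n + 1) / 12 + (11 ^ n - 1) / 2)
        - x ^ ((11 ^ n + 1) / 12 + (11 ^ n - 1) / 2) = b := by
  classical
  obtain ⟨z, hz, hz1⟩ := exists_pow_ten_ne_one hn3 hF
  obtain ⟨β, η, hβ, hη, h⟩ := exists_sign_pow_twelve hn hF hz
  -- The integers 1, ..., 5 represent the nonzero elements of the prime field up to sign.
  have hk : ∀ i : Fin 5, (((i : ℕ) + 1 : ℕ) : F) ≠ 0 := fun i =>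
    natCast_ne_zero_of_lt (by omega) (by omega)
  have hk10 : ∀ i : Fin 5, (((i : ℕ) + 1 : ℕ) : F) ^ 10 = 1 := fun i =>
    natCast_pow_ten_eq_one (hk i)
  have hsol : ∀ i : Fin 5, ∃ x, SignedSolution (η * β ^ 2) 1 1 x ∧
      4 * x ^ ((11 ^ n + 1) / 12 + (11 ^ n - 1) / 2) =
        β ^ 2 * ((z * ((i : ℕ) + 1 : ℕ)) ^ 2 + ((z * ((i : ℕ) + 1 : ℕ)) ^ 2)⁻¹)
          - 2 * (η * β ^ 2) := by
    intro i
    refine exists_signedSolution_same hn hF hη (mul_ne_zero hz (hk i)) ?_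
    rw [mul_pow, mul_pow, hk10, show 20 = 10 * 2 from rfl, pow_mul (((i : ℕ) + 1 : ℕ) : F), hk10]
    linear_combination h
  choose x hx hfx using hsol
  obtain ⟨y, hy⟩ := exists_signedSolution_opposite hn hF hη hz h
  have hinj : Function.Injective x := by
    intro i j hij
    have e := (hfx i).symm.trans ((congrArg _ (by rw [hij])).trans (hfx j))
    have hi := mul_ne_zero hz (hk i)
    have hj := mul_ne_zero hz (hk j)
    apply natCast_sq_injective (F := F)
    have hki := hk10 i
    have hkj := hk10 j
    generalize (((i : ℕ) + 1 : ℕ) : F) = k at *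
    generalize (((j : ℕ) + 1 : ℕ) : F) = l at *
    have e2 : (z * k) ^ 2 + ((z * k) ^ 2)⁻¹ = (z * l) ^ 2 + ((z * l) ^ 2)⁻¹ := by
      apply mul_left_cancel₀ (pow_ne_zero 2 hβ)
      linear_combination e
    -- p + 1/p = r + 1/r forces p = r or pr = 1; the latter, raised to the fifth power, gives z ^ 20
    -- = 1.
    have e3 : ((z * k) ^ 2 - (z * l) ^ 2) * ((z * k) ^ 2 * (z * l) ^ 2 - 1) = 0 := by
      have hi2 := pow_ne_zero 2 hi
      have hj2 := pow_ne_zero 2 hj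
      generalize (z * k) ^ 2 = p at *
      generalize (z * l) ^ 2 = r at *
      field_simp at e2
      linear_combination e2
    rcases mul_eq_zero.1 e3 with e3 | e3
    · apply mul_left_cancel₀ (pow_ne_zero 2 hz)
      linear_combination e3
    · exfalso
      have e4 : z ^ 20 = 1 := by
        calc z ^ 20 = z ^ 20 * k ^ 10 * l ^ 10 := by rw [hki, hkj]; ring
          _ = ((z * k) ^ 2 * (z * l) ^ 2) ^ 5 := by ring
          _ = 1 := by rw [sub_eq_zero.1 e3, one_pow]
      have e5 : (z ^ 10 - 1) * (z ^ 10 + 1) = 0 := by linear_combination e4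
      rcases mul_eq_zero.1 e5 with e5 | e5
      · exact hz1 (sub_eq_zero.1 e5)
      · exact neg_one_ne_sq hn hF (z ^ 5) (by linear_combination e5)
  have hyx : y ∉ Finset.univ.image x := by
    intro hmem
    obtain ⟨i, -, rfl⟩ := Finset.mem_image.1 hmem
    obtain ⟨rfl, hb⟩ := eq_one_of_signedSolution_same_opposite hn hF hη (hx i) hy
    rw [one_mul] at hb
    -- A coincidence forces β ^ 2 = 1, so `h` becomes 1 + z ^ 20 = 2z ^ 10.
    rw [show 12 = 2 * 6 from rfl, pow_mul, hb] at h
    apply hz1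
    have : (z ^ 10 - 1) ^ 2 = 0 := by linear_combination h
    exact sub_eq_zero.1 ((pow_eq_zero_iff two_ne_zero).1 this)
  refine ⟨η * β ^ 2, insert y (Finset.univ.image x), ?_, ?_⟩
  · rw [Finset.card_insert_of_notMem hyx, Finset.card_image_of_injective _ hinj]
    simp
  · intro u hu
    rcases Finset.mem_insert.1 hu with rfl | hu
    · refine sub_eq_of_signedSolution hn hF hη ?_ hy
      rcases hη with rfl | rfl
      · exact Or.inr rfl
      · exact Or.inl (neg_neg 1)
    · obtain ⟨i, -, rfl⟩ := Finset.mem_image.1 hu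
      exact sub_eq_of_signedSolution hn hF (Or.inl rfl) (Or.inl rfl) (hx i)

end

/-! ### Reduction to a = 1 by homogeneity, and conclusion -/

theorem differentialCount_pow_eq_one {F : Type*} [Field F] (d : ℕ) {a : F} (ha : a ≠ 0) (b : F) :
    differentialCount (fun x : F => x ^ d) a b =
      differentialCount (fun x : F => x ^ d) 1 (b / a ^ d) := by
  refine Nat.card_congr ((Equiv.divRight₀ a ha).subtypeEquiv fun x => ?_)
  have had : a ^ d ≠ 0 := pow_ne_zero _ ha
  change _ ↔ (x / a + 1) ^ d - (x / a) ^ d = b / a ^ d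
  rw [div_add_one ha, div_pow, div_pow, ← sub_div, div_left_inj' had]

theorem mainTheorem6 (n : ℕ) (hn : Odd n) (hn3 : 3 ≤ n)
    (F : Type*) [Field F] [Fintype F] (hF : Fintype.card F = 11 ^ n) :
    IsDifferentiallyUniform
      (fun x : F => x ^ ((11 ^ n + 1) / 12 + (11 ^ n - 1) / 2)) 6 := by
  classical
  have : CharP F 11 := charP_eleven hF
  have hcount : ∀ b : F, differentialCount
      (fun x : F => x ^ ((11 ^ n + 1) / 12 + (11 ^ n - 1) / 2)) 1 b =
      (Finset.univ.filter fun x : F => (x + 1) ^ ((11 ^ n + 1) / 12 + (11 ^ n - 1) / 2)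
        - x ^ ((11 ^ n + 1) / 12 + (11 ^ n - 1) / 2) = b).card := by
    intro b
    rw [differentialCount, Nat.card_eq_fintype_card, Fintype.card_subtype]
  apply le_antisymm
  · refine Finset.sup_le fun ab hab => ?_
    rw [differentialCount_pow_eq_one _ (Finset.mem_filter.1 hab).2, hcount]
    exact card_solutions_le_six hn hF _ _ fun x hx => (Finset.mem_filter.1 hx).2
  · obtain ⟨b, s, hs, h⟩ := exists_six_solutions hn hn3 hF
    calc 6 = s.card := hs.symm
      _ ≤ _ := Finset.card_le_card fun x hx => Finset.mem_filter.2 ⟨Finset.mem_univ x, h x hx⟩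
      _ = _ := (hcount b).symm
      _ ≤ _ := Finset.le_sup (f := fun ab : F × F => differentialCount
        (fun x : F => x ^ ((11 ^ n + 1) / 12 + (11 ^ n - 1) / 2)) ab.1 ab.2) (b := (1, b))
        (Finset.mem_filter.2 ⟨Finset.mem_univ _, one_ne_zero⟩)
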